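/- Let $\mathcal H$ be a complex Hilbert space with an orthonormal basis $\mathfrak e=(e_j)_{j=1}^\infty$ (so $\mathcal H$ is separable and infinite-dimensional), let $A$ be a compact operator on $\mathcal H$, and let $\mathbf d=(d_j)_{j=1}^\infty$, $d_j=\langle Ae_j,e_j\rangle$, be its diagonal in this basis. Let $\mathbf s=(s_j)_{j=1}^\infty$ be the singular value sequence of $A$: $s_j$ is the $j$-th largest square root of an eigenvalue of $A^*A$, counted with multiplicity (so that only the positive singular values are listed if $A$ has infinite rank, and the sequence is continued by zeros if $A$ has finite rank). Let $|d|^*_j$ be the $j$-th largest term of the sequence of moduli $(|d_i|)_{i=1}^\infty$, counted with multiplicity (again zeros are omitted if infinitely many $d_i$ are nonzero). If $$\liminf_{n\to\infty}\sum_{j=1}^n\bigl(s_j-|d|^*_j\bigr)=0,$$ then $A=UB$ for some unitary operator $U$ that is diagonal with respect to $\mathfrak e$ and some positive (that is, positive semidefinite) compact operator $B$. -/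

import Mathlib

open Filter Topology
open scoped InnerProductSpace

/-- The nonincreasing rearrangement of a nonnegative family `f` (with finitely many terms above each
`t > 0`): the term of index `n` (counting from `0`) is the `(n + 1)`-th largest term of `f`,
respecting multiplicity, that is, the least `t ≥ 0` such that at most `n` terms of `f` exceed `t`.
If `f` has finite support it ends in zeros; if `f` has infinite support all its terms are positive. -/
noncomputable def nonincRearrangement {ι : Type*} (f : ι → ℝ) (n : ℕ) : ℝ :=
  sInf {t : ℝ | 0 ≤ t ∧ {i | t < f i}.encard ≤ n}

section

variable {H : Type*} [NormedAddCommGroup H] [InnerProductSpace ℂ H] [CompleteSpace H]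

/-- Index set of the eigenvalues of `A* A`, `A` compact, repeated according to multiplicity: each
`μ : ℝ` is listed as many times as the dimension of the eigenspace of `A* A` for `μ`
(not at all if `μ` is not an eigenvalue). For compact `A` this dimension is finite for `μ ≠ 0`; how often
`μ = 0` is listed is irrelevant, see below. -/
abbrev EigIndex (A : H →L[ℂ] H) : Type :=
  Σ μ : ℝ, Fin (Module.finrank ℂ
    (Module.End.eigenspace ((ContinuousLinearMap.adjoint A ∘L A : H →L[ℂ] H) : H →ₗ[ℂ] H) (μ : ℂ)))

/-- The singular value sequence of a compact operator `A`, indexed from `0`: the square roots of the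
eigenvalues of `A* A`, counted with multiplicity and arranged in nonincreasing order. An eigenvalue
`0` does not influence the sequence, which is padded by zeros if `A` has finite rank. -/
noncomputable def singularValueSeq (A : H →L[ℂ] H) : ℕ → ℝ :=
  nonincRearrangement (fun p : EigIndex A => √p.1)

/-- `d` is the diagonal of `A` with respect to the orthonormal basis `e`, that is,
`d j = ⟨A e_j, e_j⟩` for the inner product that is linear in the first variable (Mathlib's is linear
in the second). -/
def IsDiagonalOf (e : HilbertBasis ℕ ℂ H) (A : H →L[ℂ] H) (d : ℕ → ℂ) : Prop :=
  ∀ j, d j = ⟪e j, A (e j)⟫_ℂ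

/-- `U` is a unitary operator that is diagonal in the orthonormal basis `e`. -/
def IsDiagonalUnitary (e : HilbertBasis ℕ ℂ H) (U : H →L[ℂ] H) : Prop :=
  U ∈ unitary (H →L[ℂ] H) ∧ ∃ z : ℕ → ℂ, ∀ j, U (e j) = z j • e j

end

/-! Multiplying `A` by a diagonal unitary gives `B = U* A` with diagonal `|d j|` and the same
singular values, since `B* B = A* A`. Write `B = ∑ σ p ⟨v p, ·⟩ u p`. Its trace over `n` basis
vectors is `∑ σ p * a p` with `a p ≤ 1` and `∑ |a p| ≤ n`. If `t` is the singular value of index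
`n`, the trace falls short of the sum of the first `n` singular values by at least `(σ k - t) * (1 -
a k)` whenever `σ k > t` (`sub_mul_one_sub_partialTrace_le`). The liminf condition makes this
deficit arbitrarily small for suitable large `n`, while `t ≤ σ k / 2`, so `a k` comes arbitrarily
close to `1`. This forces `u k = v k` (`norm_sub_le_of_partialTrace`), and `B = ∑ σ p ⟨v p, ·⟩ v p`
is positive. -/

/-! ### Partial sums of nonincreasing rearrangements. -/

section Rearrangement

variable {ι : Type*} {f : ι → ℝ}

lemma nonincRearrangement_bddBelow (f : ι → ℝ) (n : ℕ) :
    BddBelow {t : ℝ | 0 ≤ t ∧ {i | t < f i}.encard ≤ n} :=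
  ⟨0, fun _ ht => ht.1⟩

lemma nonincRearrangement_nonempty {M : ℝ} (hM : 0 ≤ M) (hf : ∀ i, f i ≤ M) (n : ℕ) :
    {t : ℝ | 0 ≤ t ∧ {i | t < f i}.encard ≤ n}.Nonempty := by
  refine ⟨M, hM, ?_⟩
  have : {i | M < f i} = ∅ := by
    ext i; simpa using hf i
  simp [this]

lemma nonincRearrangement_nonneg (f : ι → ℝ) (n : ℕ) : 0 ≤ nonincRearrangement f n :=
  Real.sInf_nonneg fun _ ht => ht.1

lemma nonincRearrangement_le {t : ℝ} (ht : 0 ≤ t) {n : ℕ} (hn : {i | t < f i}.encard ≤ n) :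
    nonincRearrangement f n ≤ t :=
  csInf_le (nonincRearrangement_bddBelow f n) ⟨ht, hn⟩

lemma nonincRearrangement_antitone {M : ℝ} (hM : 0 ≤ M) (hf : ∀ i, f i ≤ M) :
    Antitone (nonincRearrangement f) := fun m n hmn =>
  csInf_le_csInf (nonincRearrangement_bddBelow f n) (nonincRearrangement_nonempty hM hf m)
    fun _ ht => ⟨ht.1, ht.2.trans (by exact_mod_cast hmn)⟩

/-- If `n + 1` terms of `f` are at least `m`, then so is the term of index `n` of the
rearrangement. -/
lemma le_nonincRearrangement {M : ℝ} (hM : 0 ≤ M) (hf : ∀ i, f i ≤ M) {n : ℕ} {K : Finset ι}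
    (hK : n < K.card) {m : ℝ} (hm : ∀ i ∈ K, m ≤ f i) : m ≤ nonincRearrangement f n := by
  refine le_csInf (nonincRearrangement_nonempty hM hf n) fun t ht => ?_
  by_contra! h
  have hsub : (K : Set ι) ⊆ {i | t < f i} := fun i hi => h.trans_le (hm i hi)
  have := (Set.encard_le_encard hsub).trans ht.2
  rw [Set.encard_coe_eq_coe_finsetCard] at this
  exact absurd (by exact_mod_cast this) hK.not_ge

lemma sum_le_sum_nonincRearrangement {M : ℝ} (hM : 0 ≤ M) (hf : ∀ i, f i ≤ M) (K : Finset ι) :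
    ∑ i ∈ K, f i ≤ ∑ j ∈ Finset.range K.card, nonincRearrangement f j := by
  classical
  induction h : K.card generalizing K with
  | zero => simp [Finset.card_eq_zero.mp h]
  | succ n ih =>
    obtain ⟨i, hi, hmin⟩ := K.exists_min_image f (Finset.card_pos.mp (by omega))
    have hc : (K.erase i).card = n := by rw [Finset.card_erase_of_mem hi, h]; rfl
    rw [← Finset.sum_erase_add K f hi, Finset.sum_range_succ]
    exact add_le_add (ih _ hc) (le_nonincRearrangement hM hf (by omega) hmin)

/-- With `t` the term of index `n`, the sum of the first `n` terms is at least
`n * t` plus any finite sum of the excesses of terms of `f` over `t`. -/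
lemma mul_add_sum_sub_le_sum_nonincRearrangement {M : ℝ} (hM : 0 ≤ M) (hf : ∀ i, f i ≤ M) (n : ℕ)
    {K : Finset ι} (hK : ∀ i ∈ K, nonincRearrangement f n < f i) :
    n * nonincRearrangement f n + ∑ i ∈ K, (f i - nonincRearrangement f n) ≤
      ∑ j ∈ Finset.range n, nonincRearrangement f j := by
  set t := nonincRearrangement f n with ht
  have hcard : K.card ≤ n := by
    by_contra! h
    obtain ⟨i, hi, hmin⟩ := K.exists_min_image f (Finset.card_pos.mp (by omega))
    exact (hK i hi).not_ge (le_nonincRearrangement hM hf h hmin)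
  have h1 := sum_le_sum_nonincRearrangement hM hf K
  have h2 : ∑ j ∈ Finset.range K.card, (nonincRearrangement f j - t) ≤
      ∑ j ∈ Finset.range n, (nonincRearrangement f j - t) :=
    Finset.sum_le_sum_of_subset_of_nonneg (by simpa using hcard) fun j hj _ =>
      sub_nonneg.mpr (nonincRearrangement_antitone hM hf (Finset.mem_range.mp hj).le)
  simp only [Finset.sum_sub_distrib, Finset.sum_const, Finset.card_range, nsmul_eq_mul] at h2 ⊢
  linarith

/-- The partial sums of the rearrangement are approximated from below by finite sums of terms. -/
lemma exists_finset_sum_nonincRearrangement_le [Infinite ι] {M : ℝ} (h0 : ∀ i, 0 ≤ f i)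
    (hf : ∀ i, f i ≤ M) (n : ℕ) {δ : ℝ} (hδ : 0 < δ) :
    ∃ Λ : Finset ι, Λ.card = n ∧
      ∑ j ∈ Finset.range n, nonincRearrangement f j ≤ ∑ i ∈ Λ, f i + n * δ := by
  classical
  induction n with
  | zero => exact ⟨∅, by simp⟩
  | succ n ih =>
    obtain ⟨Λ, hc, hΛ⟩ := ih
    obtain ⟨i₀, hi₀⟩ := Infinite.exists_notMem_finset Λ
    set S : Set ℝ := f '' {i | i ∉ Λ}
    have hS : BddAbove S := ⟨M, by rintro _ ⟨i, -, rfl⟩; exact hf i⟩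
    have hne : S.Nonempty := ⟨f i₀, i₀, hi₀, rfl⟩
    -- Only the `n` indices in `Λ` can exceed the supremum off `Λ`. It need not be attained, hence
    -- the loss `δ`.
    have hle : nonincRearrangement f n ≤ sSup S := by
      refine nonincRearrangement_le ((h0 i₀).trans (le_csSup hS ⟨i₀, hi₀, rfl⟩)) ?_
      have hsub : {i | sSup S < f i} ⊆ (Λ : Set ι) := fun i hi => by
        by_contra h
        exact (le_csSup hS ⟨i, h, rfl⟩).not_gt hi
      refine (Set.encard_le_encard hsub).trans ?_
      rw [Set.encard_coe_eq_coe_finsetCard, hc]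
    obtain ⟨_, ⟨i, hi, rfl⟩, hlt⟩ := exists_lt_of_lt_csSup hne (sub_lt_self (sSup S) hδ)
    refine ⟨insert i Λ, by rw [Finset.card_insert_of_notMem hi, hc], ?_⟩
    rw [Finset.sum_insert hi, Finset.sum_range_succ]
    push_cast
    linarith

end Rearrangement

/-! ### Singular value decomposition of a compact operator. -/

section SingularSystem

variable {H : Type*} [NormedAddCommGroup H] [InnerProductSpace ℂ H] [CompleteSpace H]

open ContinuousLinearMap Module.End

lemma norm_sq_apply_of_adjoint_apply {A : H →L[ℂ] H} {μ : ℝ} {x : H}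
    (h : (adjoint A) (A x) = (μ : ℂ) • x) : ‖A x‖ ^ 2 = μ * ‖x‖ ^ 2 := by
  have h1 : ⟪x, (adjoint A) (A x)⟫_ℂ = ⟪A x, A x⟫_ℂ := adjoint_inner_right _ _ _
  rw [h, inner_smul_right, inner_self_eq_norm_sq_to_K, inner_self_eq_norm_sq_to_K] at h1
  have h2 : ((‖A x‖ ^ 2 : ℝ) : ℂ) = ((μ * ‖x‖ ^ 2 : ℝ) : ℂ) := by
    push_cast; exact h1.symm
  exact Complex.ofReal_injective h2

/-- An orthonormal family `v` of eigenvectors of `A* A` for its nonzero eigenvalues, indexed as in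
the definition of the singular values; it determines `A` since its orthogonal complement is the
kernel of `A`. -/
lemma exists_singular_system {A : H →L[ℂ] H} (hA : IsCompactOperator A) :
    ∃ v : {p : EigIndex A // p.1 ≠ 0} → H, Orthonormal ℂ v ∧
      (∀ p, (adjoint A) (A (v p)) = ((p.1.1 : ℝ) : ℂ) • v p) ∧
      ∀ x, HasSum (fun p => ⟪v p, x⟫_ℂ • A (v p)) (A x) := by
  set T : H →L[ℂ] H := adjoint A ∘L A with hT
  have hTc : IsCompactOperator T := hA.clm_comp (adjoint A)
  have hTs : (T : H →ₗ[ℂ] H).IsSymmetric := fun x y => by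
    simp [hT, adjoint_inner_left, adjoint_inner_right]
  have hfd (μ : ℝ) (hμ : μ ≠ 0) : FiniteDimensional ℂ (eigenspace (T : H →ₗ[ℂ] H) (μ : ℂ)) :=
    finite_dimensional_eigenspace hTc _ (by exact_mod_cast hμ)
  let b (μ : ℝ) (hμ : μ ≠ 0) :=
    haveI := hfd μ hμ
    stdOrthonormalBasis ℂ (eigenspace (T : H →ₗ[ℂ] H) (μ : ℂ))
  let v : {p : EigIndex A // p.1 ≠ 0} → H := fun p => (b p.1.1 p.2 p.1.2 : H)
  have hv : Orthonormal ℂ v := by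
    classical
    rw [orthonormal_iff_ite]
    rintro ⟨⟨μ, i⟩, hμ⟩ ⟨⟨ν, j⟩, hν⟩
    by_cases h : μ = ν
    · subst h
      have hb := orthonormal_iff_ite.mp (b μ hμ).orthonormal i j
      by_cases hij : i = j
      · subst hij
        rw [if_pos rfl] at hb ⊢
        exact hb
      · rw [if_neg hij] at hb
        rw [if_neg fun hp => hij (by cases hp; rfl)]
        exact hb
    · have h' : (μ : ℂ) ≠ ν := by exact_mod_cast h
      rw [if_neg fun hp => h (congrArg (fun p => p.1.1) hp)]
      exact hTs.orthogonalFamily_eigenspaces h' _ _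
  have hTv (p) : T (v p) = ((p.1.1 : ℝ) : ℂ) • v p :=
    mem_eigenspace_iff.mp (b p.1.1 p.2 p.1.2).2
  refine ⟨v, hv, hTv, fun x => ?_⟩
  have hsum : Summable fun p => ⟪v p, x⟫_ℂ • v p := by
    have := hv.orthogonalFamily.summable_iff_norm_sq_summable (fun p => ⟪v p, x⟫_ℂ)
    simp only [LinearIsometry.toSpanSingleton_apply] at this
    exact this.mpr (hv.inner_products_summable x)
  set y := x - ∑' p, ⟪v p, x⟫_ℂ • v p with hy
  have hvy (p) : ⟪v p, y⟫_ℂ = 0 := by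
    have h1 := (innerSL ℂ (v p)).hasSum hsum.hasSum
    have h2 : HasSum (fun q => innerSL ℂ (v p) (⟪v q, x⟫_ℂ • v q)) ⟪v p, x⟫_ℂ := by
      classical
      have h3 := hasSum_single (f := fun q => innerSL ℂ (v p) (⟪v q, x⟫_ℂ • v q)) p
        (fun q hq => by simp [hv.2 hq.symm])
      simpa [inner_smul_right, inner_self_eq_norm_sq_to_K, hv.1 p] using h3
    rw [hy, inner_sub_right, sub_eq_zero]
    exact h2.unique h1
  -- `T y` is orthogonal to all eigenspaces: by symmetry for eigenvalue `0`, by `hvy` for the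
  -- others. These span a dense subspace.
  have hTy : T y = 0 := by
    have hmem : T y ∈ (⨆ μ, eigenspace (T : Module.End ℂ H) μ)ᗮ := by
      rw [Submodule.mem_orthogonal]
      intro z hz
      induction hz using Submodule.iSup_induction' with
      | zero => simp
      | add z w _ _ h1 h2 => rw [inner_add_left, h1, h2, add_zero]
      | mem μ z hz =>
        have hTz : T z = μ • z := mem_eigenspace_iff.mp hz
        have hs : ⟪z, T y⟫_ℂ = ⟪T z, y⟫_ℂ := (hTs z y).symm
        rw [hs, hTz, inner_smul_left]
        by_cases hz0 : z = 0
        · simp [hz0]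
        have hre : (starRingEnd ℂ) μ = μ :=
          hTs.conj_eigenvalue_eq_self (hasEigenvalue_of_hasEigenvector ⟨hz, hz0⟩)
        obtain ⟨r, rfl⟩ := Complex.conj_eq_iff_real.mp hre
        by_cases hr : r = 0
        · simp [hr]
        have := hfd r hr
        have hexp : _ = z := congrArg Subtype.val ((b r hr).sum_repr' ⟨z, hz⟩)
        rw [← hexp]
        simp only [Submodule.coe_sum, Submodule.coe_smul, sum_inner, inner_smul_left]
        rw [Finset.sum_eq_zero, mul_zero]
        intro i _
        have := hvy ⟨⟨r, i⟩, hr⟩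
        simp only [v] at this
        rw [this, mul_zero]
    rw [orthogonalComplement_iSup_eigenspaces_eq_bot hTc hTs] at hmem
    simpa using hmem
  have hAy : A y = 0 := by
    have := norm_sq_apply_of_adjoint_apply (A := A) (μ := 0) (x := y) (by simpa [hT] using hTy)
    simpa using this
  have hAx : A x = A (∑' p, ⟪v p, x⟫_ℂ • v p) := by
    rw [hy, map_sub, sub_eq_zero] at hAy
    exact hAy
  rw [hAx]
  simpa using A.hasSum hsum.hasSum

omit [CompleteSpace H] in
/-- A compact operator that is nowhere small on an orthogonal family of images has finitely many of
them. -/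
lemma IsCompactOperator.finite_lt_norm_apply {A : H →L[ℂ] H} (hA : IsCompactOperator A)
    {κ : Type*} {v : κ → H} (hv : ∀ p, ‖v p‖ ≤ 1)
    (horth : Pairwise fun p q => ⟪A (v p), A (v q)⟫_ℂ = 0) {t : ℝ} (ht : 0 < t) :
    {p | t < ‖A (v p)‖}.Finite := by
  by_contra hinf
  let g := Set.Infinite.natEmbedding _ hinf
  have hcomp := hA.isCompact_closure_image_closedBall (f := (A : H →ₗ[ℂ] H)) 1
  obtain ⟨a, -, φ, hφ, hlim⟩ := hcomp.tendsto_subseq (x := fun n => A (v (g n)))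
    fun n => subset_closure ⟨v (g n), by simpa using hv _, rfl⟩
  obtain ⟨N, hN⟩ := Metric.cauchySeq_iff'.mp hlim.cauchySeq t ht
  have h := hN (N + 1) (by omega)
  have hne : (g (φ (N + 1)) : κ) ≠ g (φ N) := fun h => by
    have := g.injective (Subtype.ext h)
    exact absurd (hφ.injective this) (by omega)
  have h1 := norm_sub_sq (𝕜 := ℂ) (A (v (g (φ (N + 1))))) (A (v (g (φ N))))
  rw [horth hne] at h1
  have h2 : t < ‖A (v (g (φ (N + 1))))‖ := (g (φ (N + 1))).2
  simp only [Function.comp, dist_eq_norm] at h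
  simp only [map_zero, mul_zero, sub_zero] at h1
  nlinarith [norm_nonneg (A (v (g (φ (N + 1)))) - A (v (g (φ N)))), sq_nonneg ‖A (v (g (φ N)))‖]

end SingularSystem

/-! ### Partial traces and their deficit. -/

section TraceInequality

variable {H : Type*} [NormedAddCommGroup H] [InnerProductSpace ℂ H]

/-- The contribution of the vectors `u`, `v` to a partial trace over `e j`, `j ∈ Λ`. -/
noncomputable def partialTrace (e : ℕ → H) (Λ : Finset ℕ) (v u : H) : ℝ :=
  (∑ j ∈ Λ, ⟪v, e j⟫_ℂ * ⟪e j, u⟫_ℂ).re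

variable {e : ℕ → H} (he : Orthonormal ℂ e) (Λ : Finset ℕ)

-- Compare both vectors with the projection `w` of `u` to the span of `e j`, `j ∈ Λ`. As `a = Re ⟨v,
-- w⟩ ≤ ‖w‖ ≤ 1`, both `‖u - w‖ ^ 2` and `‖v - w‖ ^ 2` are at most `2 * (1 - a)`.
include he in
lemma norm_sub_le_of_partialTrace {u v : H} (hu : ‖u‖ = 1) (hv : ‖v‖ = 1) :
    partialTrace e Λ v u ≤ 1 ∧ ‖u - v‖ ^ 2 ≤ 8 * (1 - partialTrace e Λ v u) := by
  set a := partialTrace e Λ v u with ha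
  set w : H := ∑ j ∈ Λ, ⟪e j, u⟫_ℂ • e j with hw
  have hav : (⟪v, w⟫_ℂ).re = a := by
    simp only [ha, partialTrace, hw, inner_sum, inner_smul_right, mul_comm]
  have hwu : ⟪u, w⟫_ℂ = ⟪w, w⟫_ℂ := by
    conv_rhs => rw [hw, he.inner_sum]
    simp only [hw, inner_sum, inner_smul_right]
    refine Finset.sum_congr rfl fun j _ => ?_
    rw [inner_conj_symm, mul_comm]
  have hwu' : (⟪u, w⟫_ℂ).re = ‖w‖ ^ 2 := by
    rw [hwu, inner_self_eq_norm_sq_to_K]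
    norm_cast
  have h1 := norm_sub_sq (𝕜 := ℂ) u w
  have h2 := norm_sub_sq (𝕜 := ℂ) v w
  simp only [RCLike.re_to_complex, hwu', hav, hu, hv] at h1 h2
  have h3 : a ≤ ‖w‖ := by
    rw [← hav]
    have := (Complex.re_le_norm _).trans (norm_inner_le_norm (𝕜 := ℂ) v w)
    rwa [hv, one_mul] at this
  have h4 : ‖w‖ ≤ 1 := by nlinarith [sq_nonneg ‖u - w‖, norm_nonneg w]
  have h5 : ‖u - v‖ ≤ ‖u - w‖ + ‖v - w‖ := by
    have := norm_sub_le (u - w) (v - w)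
    rwa [sub_sub_sub_cancel_right] at this
  refine ⟨h3.trans h4, ?_⟩
  have h6 : ‖u - w‖ ^ 2 ≤ 2 * (1 - a) := by nlinarith [norm_nonneg w, sq_nonneg (‖w‖ - 1)]
  have h7 : ‖v - w‖ ^ 2 ≤ 2 * (1 - a) := by nlinarith [norm_nonneg w]
  have h8 : ‖u - v‖ ^ 2 ≤ (‖u - w‖ + ‖v - w‖) ^ 2 :=
    pow_le_pow_left₀ (norm_nonneg _) h5 2
  nlinarith [sq_nonneg (‖u - w‖ - ‖v - w‖)]

-- AM-GM on each product, then Bessel's inequality for `v` and for `u` at each `e j`.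
include he in
lemma sum_abs_partialTrace_le {κ : Type*} {v u : κ → H} (hv : Orthonormal ℂ v)
    (hu : Orthonormal ℂ u) (F : Finset κ) :
    ∑ p ∈ F, |partialTrace e Λ (v p) (u p)| ≤ Λ.card := by
  have hterm (p : κ) : |partialTrace e Λ (v p) (u p)| ≤
      ∑ j ∈ Λ, (‖⟪v p, e j⟫_ℂ‖ ^ 2 + ‖⟪u p, e j⟫_ℂ‖ ^ 2) / 2 := by
    refine (Complex.abs_re_le_norm _).trans ((norm_sum_le _ _).trans
      (Finset.sum_le_sum fun j _ => ?_))
    rw [norm_mul, norm_inner_symm (e j)]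
    nlinarith [sq_nonneg (‖⟪v p, e j⟫_ℂ‖ - ‖⟪u p, e j⟫_ℂ‖)]
  calc ∑ p ∈ F, |partialTrace e Λ (v p) (u p)|
      ≤ ∑ p ∈ F, ∑ j ∈ Λ, (‖⟪v p, e j⟫_ℂ‖ ^ 2 + ‖⟪u p, e j⟫_ℂ‖ ^ 2) / 2 :=
        Finset.sum_le_sum fun p _ => hterm p
    _ = ∑ j ∈ Λ, (∑ p ∈ F, ‖⟪v p, e j⟫_ℂ‖ ^ 2 + ∑ p ∈ F, ‖⟪u p, e j⟫_ℂ‖ ^ 2) / 2 := by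
        rw [Finset.sum_comm]
        simp only [← Finset.sum_div, Finset.sum_add_distrib]
    _ ≤ ∑ j ∈ Λ, (1 : ℝ) := by
        refine Finset.sum_le_sum fun j _ => ?_
        have h1 := hv.sum_inner_products_le (e j) (s := F)
        have h2 := hu.sum_inner_products_le (e j) (s := F)
        rw [he.1 j] at h1 h2
        linarith
    _ = Λ.card := by simp

include he in
/-- A quantitative form of the equality case of the trace inequality. -/
lemma sub_mul_one_sub_partialTrace_le {κ : Type*} {v u : κ → H} (hv : Orthonormal ℂ v)
    (hu : Orthonormal ℂ u) {σ : κ → ℝ} {B : H →L[ℂ] H}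
    (hB : ∀ x, HasSum (fun p => ⟪v p, x⟫_ℂ • (σ p : ℂ) • u p) (B x)) (hσ : ∀ p, 0 ≤ σ p) {t S : ℝ} (ht : 0 ≤ t)
    (hS : ∀ K : Finset κ, (∀ p ∈ K, t < σ p) → Λ.card * t + ∑ p ∈ K, (σ p - t) ≤ S)
    {k : κ} (hk : t < σ k) :
    (σ k - t) * (1 - partialTrace e Λ (v k) (u k)) ≤ S - (∑ j ∈ Λ, ⟪e j, B (e j)⟫_ℂ).re := by
  classical
  set a : κ → ℝ := fun p => partialTrace e Λ (v p) (u p) with ha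
  have htr : HasSum (fun p => σ p * a p) (∑ j ∈ Λ, ⟪e j, B (e j)⟫_ℂ).re := by
    have h1 : HasSum (fun p => ∑ j ∈ Λ, ⟪e j, ⟪v p, e j⟫_ℂ • (σ p : ℂ) • u p⟫_ℂ)
        (∑ j ∈ Λ, ⟪e j, B (e j)⟫_ℂ) :=
      hasSum_sum fun j _ => (innerSL ℂ (e j)).hasSum (hB (e j))
    have h2 := Complex.hasSum_re h1
    convert h2 using 2 with p
    change σ p * (∑ j ∈ Λ, ⟪v p, e j⟫_ℂ * ⟪e j, u p⟫_ℂ).re = _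
    rw [← Complex.re_ofReal_mul, Finset.mul_sum]
    congr 1
    refine Finset.sum_congr rfl fun j _ => ?_
    rw [inner_smul_right, inner_smul_right]
    ring
  have hbound : (∑ j ∈ Λ, ⟪e j, B (e j)⟫_ℂ).re ≤ S - (σ k - t) * (1 - a k) := by
    refine le_of_tendsto htr (eventually_atTop.mpr ⟨{k}, fun F hF => ?_⟩)
    have hkF : k ∈ F := hF (Finset.mem_singleton_self k)
    set K := F.filter fun p => t < σ p
    have hkK : k ∈ K := Finset.mem_filter.mpr ⟨hkF, hk⟩
    -- Split `σ p` as `(σ p - t) + t` when `σ p > t`; otherwise `σ p * a p ≤ t * |a p|`.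
    have h1 : ∑ p ∈ F, σ p * a p ≤ ∑ p ∈ K, (σ p - t) * a p + t * Λ.card := by
      rw [Finset.sum_filter]
      have h2 := mul_le_mul_of_nonneg_left (sum_abs_partialTrace_le he Λ hv hu F) ht
      refine le_trans ?_ (add_le_add_right h2 _)
      rw [Finset.mul_sum, ← Finset.sum_add_distrib]
      refine Finset.sum_le_sum fun p _ => ?_
      split_ifs with hp
      · nlinarith [le_abs_self (a p)]
      · rw [not_lt] at hp
        nlinarith [le_abs_self (a p), abs_nonneg (a p), hσ p]
    have h2 := hS K fun p hp => (Finset.mem_filter.mp hp).2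
    have h3 : (σ k - t) * (1 - a k) ≤ ∑ p ∈ K, (σ p - t) * (1 - a p) :=
      Finset.single_le_sum (f := fun p => (σ p - t) * (1 - a p)) (fun p hp =>
        mul_nonneg (sub_nonneg.mpr (Finset.mem_filter.mp hp).2.le)
          (sub_nonneg.mpr (norm_sub_le_of_partialTrace he Λ (hu.1 p) (hv.1 p)).1)) hkK
    simp only [mul_sub, mul_one, Finset.sum_sub_distrib] at h1 h2 h3 ⊢
    linarith
  linarith

end TraceInequality

/-! ### Diagonal unitaries and the case of nonnegative diagonal. -/

section DiagonalUnitary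

variable {H : Type*} [NormedAddCommGroup H] [InnerProductSpace ℂ H] [CompleteSpace H]

open ContinuousLinearMap

lemma exists_isDiagonalUnitary (e : HilbertBasis ℕ ℂ H) {z : ℕ → ℂ} (hz : ∀ j, ‖z j‖ = 1) :
    ∃ U : H →L[ℂ] H, IsDiagonalUnitary e U ∧ ∀ j, U (e j) = z j • e j := by
  have horth : Orthonormal ℂ fun j => z j • e j := by
    refine ⟨fun j => by simp [norm_smul, hz, e.orthonormal.1 j], fun i j hij => ?_⟩
    simp [inner_smul_left, inner_smul_right, e.orthonormal.2 hij]
  have hspan : ⊤ ≤ (Submodule.span ℂ (Set.range fun j => z j • e j)).topologicalClosure := by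
    rw [← e.dense_span]
    refine Submodule.topologicalClosure_mono (Submodule.span_le.mpr ?_)
    rintro _ ⟨j, rfl⟩
    have hj : z j ≠ 0 := fun h => by simpa [h] using hz j
    have := Submodule.smul_mem _ (z j)⁻¹
      (Submodule.subset_span (R := ℂ) (s := Set.range fun j => z j • e j) ⟨j, rfl⟩)
    simpa [smul_smul, hj] using this
  let e' := HilbertBasis.mk horth hspan
  let W : H ≃ₗᵢ[ℂ] H := e.repr.trans e'.repr.symm
  have hW (j) : W (e j) = z j • e j := by
    classical
    simp only [W, LinearIsometryEquiv.trans_apply, e.repr_self, e'.repr_symm_single]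
    exact congrFun (HilbertBasis.coe_mk horth hspan) j
  exact ⟨(Unitary.linearIsometryEquiv.symm W : unitary (H →L[ℂ] H)),
    ⟨(Unitary.linearIsometryEquiv.symm W).2, z, hW⟩, hW⟩

lemma singularValueSeq_congr {A B : H →L[ℂ] H} (h : adjoint A ∘L A = adjoint B ∘L B) :
    singularValueSeq A = singularValueSeq B := by
  unfold singularValueSeq EigIndex
  rw [h]

/-- A compact operator with nonnegative diagonal is positive if its diagonal
attains the bounds given by the singular values along a subsequence. -/
lemma isPositive_of_frequently_sum_lt (e : HilbertBasis ℕ ℂ H) {B : H →L[ℂ] H}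
    (hB : IsCompactOperator B) {r : ℕ → ℝ} (h0 : ∀ j, 0 ≤ r j)
    (hd : ∀ j, ⟪e j, B (e j)⟫_ℂ = r j)
    (hfreq : ∀ ε > 0, ∃ᶠ n : ℕ in atTop, ∑ j ∈ Finset.range n,
      (singularValueSeq B j - nonincRearrangement r j) < ε) : B.IsPositive := by
  obtain ⟨v, hv, hTv, hBv⟩ := exists_singular_system hB
  set σ : {p : EigIndex B // p.1 ≠ 0} → ℝ := fun p => √p.1.1 with hσ
  have hnorm (p) : ‖B (v p)‖ ^ 2 = p.1.1 := by
    rw [norm_sq_apply_of_adjoint_apply (hTv p), hv.1 p]; simp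
  have hpos (p) : 0 < σ p :=
    Real.sqrt_pos.mpr (lt_of_le_of_ne (hnorm p ▸ sq_nonneg _) p.2.symm)
  have hσn (p) : ‖B (v p)‖ = σ p := by
    rw [hσ, ← Real.sqrt_sq (norm_nonneg (B (v p))), hnorm]
  have hσ0 (p) : (σ p : ℂ) ≠ 0 := by exact_mod_cast (hpos p).ne'
  have horth : Pairwise fun p q => ⟪B (v p), B (v q)⟫_ℂ = 0 := fun p q hpq => by
    change ⟪B (v p), B (v q)⟫_ℂ = 0
    rw [← adjoint_inner_right, hTv, inner_smul_right, hv.2 hpq, mul_zero]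
  set u : {p : EigIndex B // p.1 ≠ 0} → H := fun p => ((σ p)⁻¹ : ℂ) • B (v p) with hu_def
  have hBu (p) : B (v p) = (σ p : ℂ) • u p := by
    rw [hu_def, smul_smul, mul_inv_cancel₀ (hσ0 p), one_smul]
  have hu : Orthonormal ℂ u := by
    refine ⟨fun p => ?_, fun p q hpq => ?_⟩
    · rw [hu_def, norm_smul, hσn, norm_inv, Complex.norm_real, Real.norm_of_nonneg (hpos p).le,
        inv_mul_cancel₀ (hpos p).ne']
    · simp only [hu_def, inner_smul_left, inner_smul_right, horth hpq, mul_zero]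
  have hBs (x) : HasSum (fun p => ⟪v p, x⟫_ℂ • (σ p : ℂ) • u p) (B x) := by
    simpa only [← hBu] using hBv x
  set f : EigIndex B → ℝ := fun p => √p.1 with hf
  have hfM (p) : f p ≤ ‖B‖ := by
    by_cases hp : p.1 = 0
    · simp [hf, hp]
    · have := B.le_opNorm (v ⟨p, hp⟩)
      rwa [hσn, hv.1, mul_one] at this
  have hrM (j) : r j ≤ ‖B‖ := by
    have h1 : ‖⟪e j, B (e j)⟫_ℂ‖ ≤ ‖e j‖ * ‖B (e j)‖ := norm_inner_le_norm _ _
    have h2 := B.le_opNorm (e j)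
    rw [e.orthonormal.1] at h1 h2
    rw [hd, Complex.norm_real, Real.norm_of_nonneg (h0 j)] at h1
    linarith
  have hM := norm_nonneg B
  have key (k) : u k = v k := by
    have hfin : {p | σ k / 2 < f p}.Finite := by
      have := hB.finite_lt_norm_apply (fun p => (hv.1 p).le) horth (half_pos (hpos k))
      refine (this.image Subtype.val).subset fun p hp => ?_
      have hp' : σ k / 2 < f p := hp
      have hp0 : p.1 ≠ 0 := fun h => by
        simp only [hf, h, Real.sqrt_zero] at hp'
        linarith [hpos k]
      exact ⟨⟨p, hp0⟩, hp'.trans_eq (hσn ⟨p, hp0⟩).symm, rfl⟩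
    -- One `ε` is the gap in `hfreq`, the other the cost of replacing the rearranged diagonal by a
    -- sum over `Λ`; `σ k / 2` bounds `σ k - t` from below.
    have hbound (ε : ℝ) (hε : 0 < ε) : ‖u k - v k‖ ^ 2 ≤ 8 * (2 * ε / (σ k / 2)) := by
      obtain ⟨n, hn, hsum⟩ := ((eventually_ge_atTop hfin.toFinset.card).and_frequently
        (hfreq ε hε)).exists
      set t := nonincRearrangement f n with ht
      have htk : t ≤ σ k / 2 := by
        refine nonincRearrangement_le (half_pos (hpos k)).le ?_
        rw [hfin.encard_eq_coe_toFinset_card]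
        exact_mod_cast hn
      obtain ⟨Λ, hΛ, hle⟩ := exists_finset_sum_nonincRearrangement_le h0 hrM n
        (δ := ε / (n + 1)) (by positivity)
      have hδ : n * (ε / (n + 1)) ≤ ε := by
        rw [mul_div_assoc', div_le_iff₀ (by positivity)]
        nlinarith
      have hS (K : Finset {p : EigIndex B // p.1 ≠ 0}) (hK : ∀ p ∈ K, t < σ p) :
          Λ.card * t + ∑ p ∈ K, (σ p - t) ≤ ∑ j ∈ Finset.range n, singularValueSeq B j := by
        have := mul_add_sum_sub_le_sum_nonincRearrangement hM hfM n
          (K := K.map (Function.Embedding.subtype _)) (by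
            simp only [Finset.mem_map]
            rintro _ ⟨p, hp, rfl⟩
            exact hK p hp)
        rw [Finset.sum_map] at this
        rw [hΛ]
        exact this
      have h1 := sub_mul_one_sub_partialTrace_le e.orthonormal Λ hv hu hBs (fun p => (hpos p).le)
        (nonincRearrangement_nonneg f n) hS (k := k) (by linarith [hpos k])
      have htr : (∑ j ∈ Λ, ⟪e j, B (e j)⟫_ℂ).re = ∑ j ∈ Λ, r j := by
        simp [hd]
      rw [htr] at h1
      rw [Finset.sum_sub_distrib] at hsum
      obtain ⟨h2, h3⟩ := norm_sub_le_of_partialTrace e.orthonormal Λ (hu.1 k) (hv.1 k)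
      refine h3.trans ?_
      gcongr
      rw [le_div_iff₀ (half_pos (hpos k))]
      nlinarith
    have hlim : Tendsto (fun ε : ℝ => 8 * (2 * ε / (σ k / 2))) (𝓝[>] 0) (𝓝 0) := by
      have : Continuous fun ε : ℝ => 8 * (2 * ε / (σ k / 2)) := by fun_prop
      simpa using (this.tendsto 0).mono_left nhdsWithin_le_nhds
    have := ge_of_tendsto hlim (eventually_mem_nhdsWithin.mono hbound)
    rw [← sub_eq_zero, ← norm_eq_zero]
    exact pow_eq_zero_iff two_ne_zero |>.mp (le_antisymm this (sq_nonneg _))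
  rw [isPositive_iff_complex]
  intro x
  have hs : HasSum (fun p => ((σ p * ‖⟪v p, x⟫_ℂ‖ ^ 2 : ℝ) : ℂ)) ⟪x, B x⟫_ℂ := by
    refine ((innerSL ℂ x).hasSum (hBs x)).congr_fun fun p => ?_
    rw [key, innerSL_apply_apply, inner_smul_right, inner_smul_right, mul_left_comm,
      ← inner_conj_symm x, Complex.mul_conj, Complex.normSq_eq_norm_sq]
    push_cast
    rfl
  have hre := Complex.hasSum_re hs
  simp only [Complex.ofReal_re] at hre
  have hx : ⟪x, B x⟫_ℂ = ((⟪x, B x⟫_ℂ).re : ℂ) := hs.unique (Complex.hasSum_ofReal.mpr hre)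
  have hnn : 0 ≤ (⟪x, B x⟫_ℂ).re :=
    hre.nonneg fun p => mul_nonneg (hpos p).le (sq_nonneg _)
  have hBx : ⟪B x, x⟫_ℂ = ⟪x, B x⟫_ℂ := by
    rw [← inner_conj_symm, hx, Complex.conj_ofReal]
  rw [hBx]
  exact ⟨hx.symm, hnn⟩

end DiagonalUnitary

/-! ### Reduction to nonnegative diagonal. -/

theorem mainTheorem4 {H : Type*} [NormedAddCommGroup H] [InnerProductSpace ℂ H] [CompleteSpace H]
    (e : HilbertBasis ℕ ℂ H) (A : H →L[ℂ] H) (hA : IsCompactOperator A)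
    (d : ℕ → ℂ) (hd : IsDiagonalOf e A d)
    (hliminf : liminf (fun n : ℕ =>
      ((∑ j ∈ Finset.range n,
        (singularValueSeq A j - nonincRearrangement (fun i => ‖d i‖) j) : ℝ) : EReal)) atTop = 0) :
    ∃ U B : H →L[ℂ] H, IsDiagonalUnitary e U ∧ B.IsPositive ∧ IsCompactOperator B ∧ A = U ∘L B := by
  have hphase (j) : ∃ z : ℂ, ‖z‖ = 1 ∧ (starRingEnd ℂ) z * d j = ‖d j‖ := by
    by_cases h : d j = 0
    · exact ⟨1, by simp [h]⟩
    · have hn : (‖d j‖ : ℂ) ≠ 0 := by simpa using h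
      refine ⟨d j / ‖d j‖, by simp [h], ?_⟩
      rw [map_div₀, Complex.conj_ofReal, div_mul_eq_mul_div, mul_comm, Complex.mul_conj,
        Complex.normSq_eq_norm_sq, div_eq_iff hn]
      push_cast
      ring
  choose z hz hzd using hphase
  obtain ⟨U, hU, hUe⟩ := exists_isDiagonalUnitary e hz
  have hUs := Unitary.mem_iff.mp hU.1
  have hUU : U ∘L ContinuousLinearMap.adjoint U = ContinuousLinearMap.id ℂ H := hUs.2
  set B : H →L[ℂ] H := ContinuousLinearMap.adjoint U ∘L A with hB
  have hBc : IsCompactOperator B := hA.clm_comp (ContinuousLinearMap.adjoint U)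
  refine ⟨U, B, hU, ?_, hBc, ?_⟩
  · have hs : singularValueSeq B = singularValueSeq A := by
      refine singularValueSeq_congr ?_
      rw [hB, ContinuousLinearMap.adjoint_comp, ContinuousLinearMap.adjoint_adjoint,
        ContinuousLinearMap.comp_assoc, ← ContinuousLinearMap.comp_assoc U, hUU,
        ContinuousLinearMap.id_comp]
    refine isPositive_of_frequently_sum_lt e hBc (fun j => norm_nonneg (d j)) (fun j => ?_)
      fun ε hε => ?_
    · rw [← hzd j, hd j, hB, ContinuousLinearMap.comp_apply,
        ContinuousLinearMap.adjoint_inner_right, hUe, inner_smul_left]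
    · rw [hs]
      -- A liminf below `ε` puts the partial sums below `ε` for infinitely many `n`.
      have := frequently_lt_of_liminf_lt (b := (ε : EReal)) (by isBoundedDefault)
        (hliminf.trans_lt (by exact_mod_cast hε))
      exact this.mono fun n hn => by exact_mod_cast hn
  · rw [hB, ← ContinuousLinearMap.comp_assoc, hUU, ContinuousLinearMap.id_comp]
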